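/- Let $N$ be a finite set of players, let each player $i\in N$ have a finite nonempty set $S_i$ of pure strategies, and put $S=\prod_{i\in N}S_i$ (the set of positions). A normal-form game on $(N,S)$ is given by a payoff matrix $P\colon S\to\mathbb R^N$. A (canonical) misinformation game is a tuple $mG=\langle G^0,(G^i)_{i\in N}\rangle$ of normal-form games on $(N,S)$ with payoff matrices $P^0$, $P^i$; $G^0$ is the actual game and $G^i$ is the game of player $i$. A natural misinformed equilibrium (nme) of $mG$ is a mixed strategy profile $\sigma=(\sigma_i)_{i\in N}$ such that each $\sigma_i$ is the strategy of player $i$ in some Nash equilibrium of $G^i$; $NME(mG)$ is the set of nme's. Put $\chi(\sigma)=\prod_{i}\operatorname{supp}(\sigma_i)\subseteq S$. For $v\in S$, let $mG_v$ be the misinformation game obtained from $mG$ by replacing, in each $P^i$ with $i\in N$, the payoff vector at position $v$ by $P^0(v)$. For a set $M$ of misinformation games put $\mathcal{AD}(M)=\{mG_v : mG\in M,\ \sigma\in NME(mG),\ v\in\chi(\sigma)\}$, let $\mathcal{AD}^{(t)}$ be the $t$-th iterate of $\mathcal{AD}$, and let $\mathcal{AD}^{*}(M)=\bigcup_{t\ge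 0}\mathcal{AD}^{(t)}(M)$. Let $\mathcal{AD}^{\infty}(M)=\mathcal{AD}^{(t)}(M)$ for the smallest $t\ge 0$ with $\mathcal{AD}^{(t+1)}(M)=\mathcal{AD}^{(t)}(M)$. A stable misinformed equilibrium (sme) of $mG$ is a mixed strategy profile $\sigma$ for which there is $\widehat{mG}\in\mathcal{AD}^{\infty}(\{mG\})$ with $\sigma\in NME(\widehat{mG})$ and $\widehat{mG}_v=\widehat{mG}$ for all $v\in\chi(\sigma)$. The terminal set of $mG$ is $\mathcal T=\{mG'\in\mathcal{AD}^{*}(\{mG\}) : mG'\in\mathcal{AD}(\{mG'\})\}$. The adaptation graph $\Gamma$ of $mG$ is the directed graph with vertex set $\mathcal{AD}^{*}(\{mG\})$ and an edge from $mG^1$ to $mG^2$ whenever $mG^2=(mG^1)_v$ for some $\sigma\in NME(mG^1)$ and $v\in\chi(\sigma)$; $\Gamma'$ is $\Gamma$ without its self-loops. Let $K$ be the set of sinks of $\Gamma'$, i.e. of the vertices of out-degree $0$ in $\Gamma'$. Then, for every misinformation game $mG$ as above: 1. $K\subseteq\mathcal T$. 2. For every $mG'\in K$, every nme of $mG'$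 is an sme of $mG$. 3. If $mG'$ is the last node of a maximal path in $\Gamma'$ starting from $mG$ (a path that cannot be extended to a longer one), then $mG'$ has at least one nme, and every nme of $mG'$ is an sme of $mG$. -/

import Mathlib

/-- A normal-form game with player set `ι`, where player `i` has the set `S i` of pure strategies:
at each position (pure strategy profile) `v`, the entry `payoff v` of the payoff matrix is the
vector of the payoffs of all the players. -/
@[ext]
structure NormalFormGame (ι : Type*) (S : ι → Type*) where
  payoff : (∀ i, S i) → ι → ℝ

/-- A misinformation game in which the actual game and the game of every player differ only in
their payoffs. -/
@[ext]
structure MisinformationGame (ι : Type*) (S : ι → Type*) where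
  /-- The actual game. -/
  actual : NormalFormGame ι S
  /-- The game of each player, i.e. her subjective view. -/
  subjective : ι → NormalFormGame ι S

/-- A profile of mixed strategies. -/
abbrev StrategyProfile (ι : Type*) (S : ι → Type*) [∀ i, Fintype (S i)] : Type _ :=
  ∀ i, stdSimplex ℝ (S i)

/-- The characteristic set of `σ`: all positions formed by pure strategies which the
players play with positive probability. -/
def characteristicSet {ι : Type*} {S : ι → Type*} [∀ i, Fintype (S i)]
    (σ : StrategyProfile ι S) : Set (∀ i, S i) :=
  {v | ∀ i, 0 < σ i (v i)}

namespace NormalFormGame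

variable {ι : Type*} {S : ι → Type*} [Fintype ι] [DecidableEq ι] [∀ i, Fintype (S i)]

/-- The expected payoff of player `i` under the mixed strategy profile `σ`. -/
def expectedPayoff (G : NormalFormGame ι S) (σ : StrategyProfile ι S) (i : ι) : ℝ :=
  ∑ s : (∀ j, S j), G.payoff s i * ∏ j, σ j (s j)

/-- The set of (mixed) Nash equilibria. -/
def nashEquilibria (G : NormalFormGame ι S) : Set (StrategyProfile ι S) :=
  {σ | ∀ (i : ι) (τ : stdSimplex ℝ (S i)),
    G.expectedPayoff (Function.update σ i τ) i ≤ G.expectedPayoff σ i}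

end NormalFormGame

namespace MisinformationGame

variable {ι : Type*} {S : ι → Type*} [Fintype ι] [DecidableEq ι]
  [∀ i, Fintype (S i)] [∀ i, DecidableEq (S i)]

/-- The natural misinformed equilibria: the strategy of each player `i` is her strategy
in some Nash equilibrium of her own game. -/
def NME (mG : MisinformationGame ι S) : Set (StrategyProfile ι S) :=
  {σ | ∀ i, ∃ τ ∈ (mG.subjective i).nashEquilibria, τ i = σ i}

/-- The `v`-update of `mG`: in every subjective payoff matrix, the payoff vector at position `v`
is replaced by the actual one. -/
def updateAt (mG : MisinformationGame ι S) (v : ∀ i, S i) : MisinformationGame ι S where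
  actual := mG.actual
  subjective i := ⟨Function.update (mG.subjective i).payoff v (mG.actual.payoff v)⟩

/-- One step of the Adaptation Procedure on a set of misinformation games. The `t`-th iterate of
the procedure is `adapt^[t]`. -/
def adapt (M : Set (MisinformationGame ι S)) : Set (MisinformationGame ι S) :=
  {mG' | ∃ mG ∈ M, ∃ σ ∈ mG.NME, ∃ v ∈ characteristicSet σ, mG' = mG.updateAt v}

/-- All the misinformation games produced by the Adaptation Procedure. -/
def adaptStar (M : Set (MisinformationGame ι S)) : Set (MisinformationGame ι S) :=
  ⋃ t : ℕ, adapt^[t] M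

/-- The Adaptation Procedure on `M` terminates at step `t`. -/
def TerminatesAt (M : Set (MisinformationGame ι S)) (t : ℕ) : Prop :=
  IsLeast {t : ℕ | adapt^[t + 1] M = adapt^[t] M} t

/-- The stable set: the iterate at the step at which the procedure terminates (it has no elements
if the procedure does not terminate). -/
def stableSet (M : Set (MisinformationGame ι S)) : Set (MisinformationGame ι S) :=
  {mG' | ∃ t, TerminatesAt M t ∧ mG' ∈ adapt^[t] M}

/-- The stable misinformed equilibria. -/
def SME (mG : MisinformationGame ι S) : Set (StrategyProfile ι S) :=
  {σ | ∃ mG' ∈ stableSet {mG}, σ ∈ mG'.NME ∧ ∀ v ∈ characteristicSet σ, mG'.updateAt v = mG'}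

/-- The terminal set of the Adaptation Procedure on `mG`. -/
def terminalSet (mG : MisinformationGame ι S) : Set (MisinformationGame ι S) :=
  {mG' ∈ adaptStar {mG} | mG' ∈ adapt {mG'}}

/-- The adaptation graph `Γ`. -/
def adaptationGraph (mG : MisinformationGame ι S) : Digraph (adaptStar {mG}) where
  Adj a b := ∃ σ ∈ a.1.NME, ∃ v ∈ characteristicSet σ, b.1 = a.1.updateAt v

/-- The loopless version `Γ'` of the adaptation graph. -/
def looplessAdaptationGraph (mG : MisinformationGame ι S) : Digraph (adaptStar {mG}) where
  Adj a b := mG.adaptationGraph.Adj a b ∧ a ≠ b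

/-- The root of the adaptation graph. -/
def root (mG : MisinformationGame ι S) : adaptStar {mG} :=
  ⟨mG, Set.mem_iUnion.2 ⟨0, Set.mem_singleton mG⟩⟩

end MisinformationGame

/-- The number of edges of a digraph that leave `a`. -/
noncomputable def Digraph.outDeg {V : Type*} (Γ : Digraph V) (a : V) : ℕ∞ :=
  {b | Γ.Adj a b}.encard

/-- The list `p` of vertices is a path of `Γ` that starts at `r`. -/
def Digraph.IsPathFrom {V : Type*} (Γ : Digraph V) (r : V) (p : List V) : Prop :=
  p.head? = some r ∧ p.IsChain Γ.Adj ∧ p.Nodup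

/-- The list `p` is a path of `Γ` that starts at `r` and cannot be extended to a longer one. -/
def Digraph.IsMaximalPathFrom {V : Type*} (Γ : Digraph V) (r : V) (p : List V) : Prop :=
  Γ.IsPathFrom r p ∧ ∀ q, Γ.IsPathFrom r q → p <+: q → q = p

/-- The sinks of the loopless adaptation graph. -/
def MisinformationGame.sinks {ι : Type*} {S : ι → Type*} [Fintype ι] [DecidableEq ι]
    [∀ i, Fintype (S i)] [∀ i, DecidableEq (S i)] (mG : MisinformationGame ι S) :
    Set (MisinformationGame ι S) :=
  {mG' | ∃ h : mG' ∈ MisinformationGame.adaptStar {mG},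
    mG.looplessAdaptationGraph.outDeg ⟨mG', h⟩ = 0}

/-!
Updating a game at a misinformed position makes that position correct for good, so every edge of
the adaptation graph that is not a loop strictly lowers the number of misinformed positions. Hence
the procedure becomes stationary, the loopless graph has no cycles, and a maximal path ends at a
sink. Since every game has a natural misinformed equilibrium, by Nash's theorem, a sink of the
loopless graph carries a loop in the adaptation graph; a game with a loop never disappears from the
iterates, hence lies in the stable set, and at a sink every update is trivial.

Nash's theorem is deduced from Brouwer's fixed point theorem, and Brouwer's theorem from the volume
argument of Milnor and Rogers: if `f` fixes the frontier of a compact convex set `K` pointwise, then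
`id + t • (f - id)` is a bijection of `K` for small `t`, so the integral over `K` of its Jacobian, a
polynomial in `t`, is the volume of `K` for all `t`, including `t = 1`.
-/

section Interpolation

open Polynomial

theorem exists_polynomial_eval_eq_det_one_add_smul {R M : Type*} [CommRing R] [Nontrivial R]
    [AddCommGroup M] [Module R M] [Module.Free R M] [Module.Finite R M] (A : M →ₗ[R] M) :
    ∃ p : R[X], p.natDegree ≤ Module.finrank R M ∧
      ∀ t, p.eval t = LinearMap.det (1 + t • A) := by
  let b := Module.finBasis R M
  let B := LinearMap.toMatrix b b A
  refine ⟨((X : R[X]) • B.map C + (1 : Matrix _ _ R).map C).det, ?_, fun t ↦ ?_⟩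
  · simpa only [Fintype.card_fin] using natDegree_det_X_add_C_le B 1
  · have heval : (evalRingHom t).mapMatrix ((X : R[X]) • B.map C + (1 : Matrix _ _ R).map C) =
        t • B + 1 := by
      ext i j
      simp [Matrix.one_apply, apply_ite, mul_comm t]
    rw [← coe_evalRingHom, RingHom.map_det, heval, ← LinearMap.det_toMatrix b, map_add, map_smul,
      LinearMap.toMatrix_one, add_comm]

theorem exists_polynomial_eval_eq_integral {α 𝕜 : Type*} [MeasurableSpace α] [RCLike 𝕜]
    {μ : MeasureTheory.Measure α} {n : ℕ} {P : α → 𝕜[X]} (hdeg : ∀ x, (P x).natDegree ≤ n)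
    (hint : ∀ t, MeasureTheory.Integrable (fun x ↦ (P x).eval t) μ) :
    ∃ p : 𝕜[X], ∀ t, p.eval t = ∫ x, (P x).eval t ∂μ := by
  let node : Fin (n + 1) → 𝕜 := fun k ↦ (k : ℕ)
  have hnode : Set.InjOn node (Finset.univ : Finset (Fin (n + 1))) :=
    (Nat.cast_injective.comp Fin.val_injective).injOn
  have hinterp : ∀ x t, (P x).eval t = ∑ k, (P x).eval (node k) *
      (Lagrange.basis Finset.univ node k).eval t := by
    intro x t
    have hlt : (P x).degree < (Finset.univ : Finset (Fin (n + 1))).card := by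
      rw [Finset.card_univ, Fintype.card_fin]
      exact degree_le_natDegree.trans_lt (mod_cast Nat.lt_succ_of_le (hdeg x))
    conv_lhs => rw [Lagrange.eq_interpolate hnode hlt, Lagrange.interpolate_apply]
    simp only [eval_finsetSum, eval_mul, eval_C]
  refine ⟨Lagrange.interpolate Finset.univ node fun k ↦ ∫ x, (P x).eval (node k) ∂μ, fun t ↦ ?_⟩
  simp only [Lagrange.interpolate_apply, eval_finsetSum, eval_mul, eval_C]
  rw [MeasureTheory.integral_congr_ae (.of_forall fun x ↦ hinterp x t),
    MeasureTheory.integral_finsetSum _ fun k _ ↦ (hint (node k)).mul_const _]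
  simp only [MeasureTheory.integral_mul_const]

end Interpolation

section Perturbation

variable {E : Type*} [NormedAddCommGroup E]

theorem bijective_id_add_of_contractingWith [CompleteSpace E] {w : E → E} {C : NNReal}
    (hw : ContractingWith C w) : Function.Bijective fun x ↦ x + w x := by
  refine (Function.bijective_iff_existsUnique _).2 fun y ↦ ?_
  have hcontr : ContractingWith C fun x ↦ y - w x :=
    ⟨hw.1, LipschitzWith.of_dist_le_mul fun a b ↦ by
      simpa only [dist_sub_left] using hw.2.dist_le_mul a b⟩
  have hfixed : ∀ x, x + w x = y ↔ Function.IsFixedPt (fun x ↦ y - w x) x := fun x ↦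
    eq_sub_iff_add_eq.symm.trans eq_comm
  simp only [hfixed]
  exact ⟨_, hcontr.fixedPoint_isFixedPt, fun _ ↦ hcontr.fixedPoint_unique⟩

variable [NormedSpace ℝ E] [FiniteDimensional ℝ E] {K : Set E} {C : NNReal}

theorem lipschitzWith_indicator_of_eqOn_frontier {F : Type*} [NormedAddCommGroup F]
    (hK : IsClosed K) {u : E → F} (hu : LipschitzOnWith C u K)
    (hzero : Set.EqOn u 0 (frontier K)) : LipschitzWith C (K.indicator u) := by
  have hcross : ∀ x ∈ K, ∀ y ∉ K, dist (u x) 0 ≤ C * dist x y := by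
    intro x hx y hy
    obtain ⟨z, hz, hxz⟩ := exists_mem_frontier_infDist_compl_eq_dist hx
      fun h ↦ hy (h ▸ Set.mem_univ y)
    calc dist (u x) 0 = dist (u x) (u z) := by rw [hzero hz, Pi.zero_apply]
      _ ≤ C * dist x z := hu.dist_le_mul x hx z (hK.frontier_subset hz)
      _ ≤ C * dist x y := by
        rw [← hxz]
        gcongr
        exact Metric.infDist_le_dist_of_mem hy
  refine LipschitzWith.of_dist_le_mul fun x y ↦ ?_
  by_cases hx : x ∈ K <;> by_cases hy : y ∈ K <;> simp only [hx, hy, Set.indicator_of_mem,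
    Set.indicator_of_notMem, not_false_eq_true, dist_self]
  · exact hu.dist_le_mul x hx y hy
  · exact hcross x hx y hy
  · rw [dist_comm, dist_comm x]
    exact hcross y hy x hx
  · positivity

theorem bijOn_id_add_of_eqOn_frontier (hK : IsClosed K) (hC : C < 1) {u : E → E}
    (hu : LipschitzOnWith C u K) (hzero : Set.EqOn u 0 (frontier K)) :
    Set.BijOn (fun x ↦ x + u x) K K := by
  have hbij : Function.Bijective fun x ↦ x + K.indicator u x :=
    have := FiniteDimensional.complete ℝ E
    bijective_id_add_of_contractingWith
      ⟨hC, lipschitzWith_indicator_of_eqOn_frontier hK hu hzero⟩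
  have hcompl : Set.BijOn (fun x ↦ x + K.indicator u x) Kᶜ Kᶜ :=
    (Set.bijOn_id Kᶜ).congr fun x hx ↦ by simp [Set.indicator_of_notMem hx]
  refine ((compl_compl K ▸ hcompl.compl hbij)).congr fun x hx ↦ ?_
  simp only [Set.indicator_of_mem hx]

end Perturbation

section NoRetraction

open MeasureTheory Filter Topology

variable {E : Type*} [NormedAddCommGroup E] [NormedSpace ℝ E]

theorem eventually_forall_det_one_add_smul_pos {X : Type*} [TopologicalSpace X] {s : Set X}
    (hs : IsCompact s) {A : X → E →L[ℝ] E} (hA : Continuous A) :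
    ∀ᶠ t : ℝ in 𝓝 0, ∀ x ∈ s, 0 < (1 + t • A x).det := by
  have hcont : Continuous fun z : ℝ × X ↦ (1 + z.1 • A z.2).det :=
    ContinuousLinearMap.continuous_det.comp
      (continuous_const.add (continuous_fst.smul (hA.comp continuous_snd)))
  refine hs.eventually_forall_of_forall_eventually fun x _ ↦
    hcont.continuousAt.eventually_const_lt ?_
  simp [ContinuousLinearMap.det]

variable [FiniteDimensional ℝ E]

theorem setIntegral_det_eq_measureReal_image [MeasurableSpace E] [BorelSpace E] (μ : Measure E)
    [μ.IsAddHaarMeasure] {s : Set E} (hs : MeasurableSet s) {f : E → E} {f' : E → E →L[ℝ] E}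
    (hf : ∀ x ∈ s, HasFDerivWithinAt f (f' x) s x) (hinj : Set.InjOn f s)
    (hdet : ∀ x ∈ s, 0 < (f' x).det) : ∫ x in s, (f' x).det ∂μ = μ.real (f '' s) := by
  have hchange := integral_image_eq_integral_abs_det_fderiv_smul μ hs hf hinj fun _ ↦ (1 : ℝ)
  simp only [smul_eq_mul, mul_one, setIntegral_const] at hchange
  rw [hchange]
  exact setIntegral_congr_fun hs fun x hx ↦ (abs_of_pos (hdet x hx)).symm

variable {K : Set E}

theorem eventually_setIntegral_det_one_add_smul_eq [MeasurableSpace E] [BorelSpace E]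
    (μ : Measure E) [μ.IsAddHaarMeasure] (hK : IsCompact K) (hconv : Convex ℝ K) {u : E → E}
    (hu : ContDiff ℝ 1 u) (hzero : Set.EqOn u 0 (frontier K)) :
    ∀ᶠ t : ℝ in 𝓝 0, ∫ x in K, (1 + t • fderiv ℝ u x).det ∂μ = μ.real K := by
  obtain ⟨C, hC⟩ := hu.contDiffOn.exists_lipschitzOnWith one_ne_zero hconv hK
  have hsmall : ∀ᶠ t : ℝ in 𝓝 0, ‖t‖₊ * C < 1 :=
    (by fun_prop : Continuous fun t : ℝ ↦ ‖t‖₊ * C).continuousAt.eventually_lt_const (by simp)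
  filter_upwards [hsmall, eventually_forall_det_one_add_smul_pos hK
    (hu.continuous_fderiv one_ne_zero)] with t ht hdet
  have hbij : Set.BijOn (fun x ↦ x + t • u x) K K :=
    bijOn_id_add_of_eqOn_frontier hK.isClosed ht ((lipschitzWith_smul t).comp_lipschitzOnWith hC)
      fun x hx ↦ by simp [hzero hx]
  have hderiv : ∀ x ∈ K,
      HasFDerivWithinAt (fun x ↦ x + t • u x) (1 + t • fderiv ℝ u x) K x := fun x _ ↦
    ((hasFDerivAt_id x).add
      ((hu.differentiable one_ne_zero x).hasFDerivAt.const_smul t)).hasFDerivWithinAt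
  rw [setIntegral_det_eq_measureReal_image μ hK.measurableSet hderiv hbij.injOn hdet,
    hbij.image_eq]

/-- Deform the identity to `f` along a segment: the integral of the Jacobian is a polynomial in
the time `t` which is constant for small `t`, hence constant. -/
theorem setIntegral_det_fderiv_eq_measureReal [MeasurableSpace E] [BorelSpace E]
    (μ : Measure E) [μ.IsAddHaarMeasure] (hK : IsCompact K) (hconv : Convex ℝ K) {f : E → E}
    (hf : ContDiff ℝ 1 f) (hid : Set.EqOn f id (frontier K)) :
    ∫ x in K, (fderiv ℝ f x).det ∂μ = μ.real K := by
  let u : E → E := fun x ↦ f x - x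
  have hu : ContDiff ℝ 1 u := hf.sub contDiff_id
  have hfu : ∀ x, fderiv ℝ f x = 1 + (1 : ℝ) • fderiv ℝ u x := fun x ↦ by
    have hsub : fderiv ℝ u x = fderiv ℝ f x - 1 :=
      ((hf.differentiable one_ne_zero x).hasFDerivAt.sub (hasFDerivAt_id x)).fderiv
    rw [hsub, one_smul, add_sub_cancel]
  choose P hPdeg hP using fun x ↦
    exists_polynomial_eval_eq_det_one_add_smul (fderiv ℝ u x : E →ₗ[ℝ] E)
  have hPdet : ∀ t x, (P x).eval t = (1 + t • fderiv ℝ u x).det := fun t x ↦ hP x t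
  have hint : ∀ t, IntegrableOn (fun x ↦ (P x).eval t) K μ := fun t ↦ by
    simp only [hPdet]
    exact (ContinuousLinearMap.continuous_det.comp (continuous_const.add
      ((hu.continuous_fderiv one_ne_zero).const_smul t))).continuousOn.integrableOn_compact hK
  obtain ⟨p, hp⟩ := exists_polynomial_eval_eq_integral hPdeg hint
  have hconst : p = Polynomial.C (μ.real K) := by
    refine Polynomial.eq_of_infinite_eval_eq _ _ (infinite_of_mem_nhds (0 : ℝ) ?_)
    filter_upwards [eventually_setIntegral_det_one_add_smul_eq μ hK hconv hu
      fun x hx ↦ sub_eq_zero.2 (hid hx)] with t ht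
    rw [Polynomial.eval_C, hp, ← ht]
    simp only [hPdet]
  calc ∫ x in K, (fderiv ℝ f x).det ∂μ = p.eval 1 := by simp only [hp, hPdet, hfu]
    _ = μ.real K := by rw [hconst, Polynomial.eval_C]

theorem det_eq_zero_of_interior_image_eq_empty {f : E → E} {f' : E →L[ℝ] E} {x : E} {s : Set E}
    (hf : HasStrictFDerivAt f f' x) (hs : s ∈ 𝓝 x) (himage : interior (f '' s) = ∅) :
    f'.det = 0 := by
  have := FiniteDimensional.complete ℝ E
  by_contra hdet
  have hopen : map f (𝓝 x) = 𝓝 (f x) :=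
    HasStrictFDerivAt.map_nhds_eq_of_equiv (f' := f'.toContinuousLinearEquivOfDetNeZero hdet) hf
  have hmem : f x ∈ interior (f '' s) := mem_interior_iff_mem_nhds.2 (hopen ▸ image_mem_map hs)
  exact Set.notMem_empty _ (himage ▸ hmem)

/-- The derivative of a map into the frontier is nowhere invertible, so the integral of the
Jacobian would be zero instead of the volume of `K`. -/
theorem not_mapsTo_frontier_of_eqOn_id (hK : IsCompact K) (hconv : Convex ℝ K)
    (hint : (interior K).Nonempty) {f : E → E} (hf : ContDiff ℝ 1 f)
    (hid : Set.EqOn f id (frontier K)) : ¬ Set.MapsTo f K (frontier K) := by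
  intro hmaps
  borelize E
  let μ : Measure E := Measure.addHaar
  have hdet : ∀ x ∈ interior K, (fderiv ℝ f x).det = 0 := fun x hx ↦
    det_eq_zero_of_interior_image_eq_empty (hf.contDiffAt.hasStrictFDerivAt one_ne_zero)
      (mem_interior_iff_mem_nhds.1 hx)
      (Set.subset_empty_iff.1 (interior_frontier hK.isClosed ▸ interior_mono hmaps.image_subset))
  have hvol : 0 < μ.real K :=
    ENNReal.toReal_pos (Measure.measure_pos_of_nonempty_interior μ hint).ne' hK.measure_lt_top.ne
  refine hvol.ne' ?_
  rw [← setIntegral_det_fderiv_eq_measureReal μ hK hconv hf hid,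
    ← setIntegral_congr_set (interior_ae_eq_of_null_frontier (hconv.addHaar_frontier μ))]
  exact setIntegral_eq_zero_of_forall_eq_zero hdet

end NoRetraction

section FixedPoint

open Metric

theorem exists_lipschitzWith_one_forall_mem_eqOn_id {E : Type*} [NormedAddCommGroup E]
    [InnerProductSpace ℝ E] {K : Set E} (hne : K.Nonempty) (hK : IsComplete K)
    (hconv : Convex ℝ K) : ∃ P : E → E, LipschitzWith 1 P ∧ (∀ x, P x ∈ K) ∧ Set.EqOn P id K := by
  choose P hPmem hPmin using exists_norm_eq_iInf_of_complete_convex hne hK hconv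
  have hobtuse : ∀ x, ∀ w ∈ K, inner ℝ (x - P x) (w - P x) ≤ 0 := fun x ↦
    (norm_eq_iInf_iff_real_inner_le_zero hconv (hPmem x)).1 (hPmin x)
  refine ⟨P, LipschitzWith.of_dist_le_mul fun x y ↦ ?_, hPmem, fun x hx ↦ ?_⟩
  · have hmono : ‖P x - P y‖ ^ 2 ≤ ‖x - y‖ * ‖P x - P y‖ := by
      refine le_trans ?_ (real_inner_le_norm (x - y) (P x - P y))
      have hxy := hobtuse x (P y) (hPmem y)
      have hyx := hobtuse y (P x) (hPmem x)
      simp only [← real_inner_self_eq_norm_sq, inner_sub_left, inner_sub_right] at *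
      linarith
    rw [dist_eq_norm, dist_eq_norm, NNReal.coe_one, one_mul]
    by_contra! hlt
    nlinarith [norm_nonneg (x - y)]
  · have hself := hobtuse x x hx
    rw [real_inner_self_nonpos, sub_eq_zero] at hself
    exact hself.symm

variable {E : Type*} [NormedAddCommGroup E] [InnerProductSpace ℝ E] [FiniteDimensional ℝ E]

/-- If `g` had no fixed point, then normalizing `x - g x` would retract a large ball onto its
boundary. -/
theorem exists_isFixedPt_of_contDiff_of_hasCompactSupport {g : E → E} (hg : ContDiff ℝ 1 g)
    (hsupp : HasCompactSupport g) : ∃ x, Function.IsFixedPt g x := by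
  by_contra! hfree
  have hne : ∀ x, x - g x ≠ 0 := fun x hx ↦ hfree x (sub_eq_zero.1 hx).symm
  obtain ⟨R, hR, hball⟩ := hsupp.isBounded.subset_ball_lt 0 0
  let f : E → E := fun x ↦ (R * ‖x - g x‖⁻¹) • (x - g x)
  have hf : ContDiff ℝ 1 f := by
    have hd : ContDiff ℝ 1 fun x ↦ x - g x := contDiff_id.sub hg
    exact (contDiff_const.mul ((hd.norm ℝ hne).inv fun x ↦ norm_ne_zero_iff.2 (hne x))).smul hd
  have hnorm : ∀ x, ‖f x‖ = R := fun x ↦ by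
    rw [norm_smul, norm_mul, norm_inv, norm_norm, Real.norm_of_nonneg hR.le, mul_assoc,
      inv_mul_cancel₀ (norm_ne_zero_iff.2 (hne x)), mul_one]
  have hfrontier : frontier (closedBall (0 : E) R) = sphere 0 R := frontier_closedBall 0 hR.ne'
  have hinterior : (interior (closedBall (0 : E) R)).Nonempty :=
    ⟨0, ball_subset_interior_closedBall (mem_ball_self hR)⟩
  refine not_mapsTo_frontier_of_eqOn_id (isCompact_closedBall 0 R) (convex_closedBall 0 R)
    hinterior hf (fun x hx ↦ ?_) fun x _ ↦ by rw [hfrontier, mem_sphere_zero_iff_norm, hnorm]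
  rw [hfrontier, mem_sphere_zero_iff_norm] at hx
  have hgx : g x = 0 := image_eq_zero_of_notMem_tsupport fun hmem ↦
    (mem_ball_zero_iff.1 (hball hmem)).ne hx
  simp only [f, hgx, sub_zero, hx, mul_inv_cancel₀ hR.ne', one_smul, id]

theorem exists_isFixedPt_of_continuous_of_hasCompactSupport {h : E → E} (hh : Continuous h)
    (hsupp : HasCompactSupport h) : ∃ x, Function.IsFixedPt h x := by
  by_contra! hfree
  obtain ⟨g, hg, hdist, hgsupp⟩ := hh.exists_contDiff_approx 1 (ε := fun x ↦ dist x (h x))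
    (continuous_id.dist hh) fun x ↦ dist_pos.2 (Ne.symm (hfree x))
  obtain ⟨x, hx⟩ := exists_isFixedPt_of_contDiff_of_hasCompactSupport hg (hsupp.mono hgsupp)
  exact (hdist x).ne (congrArg (dist · (h x)) hx)

theorem exists_isFixedPt_of_continuous_of_norm_le {f : E → E} (hf : Continuous f) {r : ℝ}
    (hr : ∀ x, ‖f x‖ ≤ r) : ∃ x, Function.IsFixedPt f x := by
  obtain ⟨φ, hone, -, hsupp, hmem⟩ := exists_continuous_one_zero_of_isCompact
    (isCompact_closedBall (0 : E) r) isClosed_empty (Set.disjoint_empty _)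
  obtain ⟨x, hx⟩ := exists_isFixedPt_of_continuous_of_hasCompactSupport (φ.continuous.smul hf)
    hsupp.smul_right
  have hnorm : ‖x‖ ≤ r := calc
    ‖x‖ = φ x * ‖f x‖ := by
      rw [← Real.norm_of_nonneg (hmem x).1, ← norm_smul]
      exact congrArg norm hx.symm
    _ ≤ ‖f x‖ := mul_le_of_le_one_left (norm_nonneg _) (hmem x).2
    _ ≤ r := hr x
  have hφ : φ x = 1 := hone (mem_closedBall_zero_iff.2 hnorm)
  exact ⟨x, by simpa only [Function.IsFixedPt, Pi.smul_apply', hφ, one_smul] using hx⟩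

/-- **Brouwer's fixed point theorem**, reduced to bounded maps of a Euclidean space by composing
with the metric projection onto `K`. -/
theorem exists_isFixedPt_of_isCompact_of_convex {V : Type*} [AddCommGroup V] [Module ℝ V]
    [TopologicalSpace V] [IsTopologicalAddGroup V] [ContinuousSMul ℝ V] [T2Space V]
    [FiniteDimensional ℝ V] {K : Set V} (hne : K.Nonempty) (hK : IsCompact K)
    (hconv : Convex ℝ K) {f : V → V} (hf : ContinuousOn f K) (hmaps : Set.MapsTo f K K) :
    ∃ x ∈ K, Function.IsFixedPt f x := by
  let e := toEuclidean (E := V)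
  obtain ⟨P, hP, hPmem, hPid⟩ := exists_lipschitzWith_one_forall_mem_eqOn_id (hne.image e)
    (hK.image e.continuous).isComplete (hconv.linear_image e.toLinearMap)
  have hPK : ∀ x, e.symm (P x) ∈ K := fun x ↦ by
    obtain ⟨y, hy, hyx⟩ := hPmem x
    rwa [← hyx, e.symm_apply_apply]
  obtain ⟨r, hr⟩ := (hK.image e.continuous).isBounded.exists_norm_le
  obtain ⟨x, hx⟩ := exists_isFixedPt_of_continuous_of_norm_le
    (e.continuous.comp (hf.comp_continuous (e.symm.continuous.comp hP.continuous) hPK))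
    fun x ↦ hr _ (Set.mem_image_of_mem e (hmaps (hPK x)))
  have hPx : P x = x := hPid ⟨_, hmaps (hPK x), hx⟩
  refine ⟨e.symm x, hPx ▸ hPK x, e.injective ?_⟩
  simpa only [Function.IsFixedPt, Function.comp_apply, hPx, e.apply_symm_apply] using hx

end FixedPoint

theorem nonpos_of_mul_sum_posPart_eq {α : Type*} [Fintype α] {x d : α → ℝ}
    (hmean : ∑ a, x a * d a = 0) (heq : ∀ a, x a * ∑ b, (d b)⁺ = (d a)⁺) (a : α) : d a ≤ 0 := by
  have hsq : ∀ b, (d b)⁺ * (d b)⁺ = (d b)⁺ * d b := fun b ↦ by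
    rcases le_total (d b) 0 with h | h
    · simp only [posPart_eq_zero.2 h, zero_mul]
    · rw [posPart_of_nonneg h]
  have hsum : ∑ b, (d b)⁺ * (d b)⁺ = 0 := calc
    ∑ b, (d b)⁺ * (d b)⁺ = ∑ b, (∑ c, (d c)⁺) * (x b * d b) := Finset.sum_congr rfl fun b _ ↦ by
      rw [hsq, ← mul_assoc, mul_comm _ (x b), heq]
    _ = 0 := by rw [← Finset.mul_sum, hmean, mul_zero]
  rw [Finset.sum_eq_zero_iff_of_nonneg fun b _ ↦ mul_self_nonneg _] at hsum
  exact posPart_eq_zero.1 (mul_self_eq_zero.1 (hsum a (Finset.mem_univ a)))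

namespace NormalFormGame

variable {ι : Type*} {S : ι → Type*} [Fintype ι] [DecidableEq ι] [∀ i, Fintype (S i)]

/-- The multilinear extension of the payoff of player `i`: the expected payoff as a function of
arbitrary real weights on the pure strategies, not only of probability weights. -/
def multilinearPayoff (G : NormalFormGame ι S) (i : ι) :
    ContinuousMultilinearMap ℝ (fun j ↦ S j → ℝ) ℝ :=
  ∑ s : (∀ j, S j), G.payoff s i •
    (ContinuousMultilinearMap.mkPiAlgebra ℝ ι ℝ).compContinuousLinearMap
      fun j ↦ ContinuousLinearMap.proj (s j)

theorem expectedPayoff_eq_multilinearPayoff (G : NormalFormGame ι S) (σ : StrategyProfile ι S)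
    (i : ι) : G.expectedPayoff σ i = G.multilinearPayoff i fun j ↦ σ j := by
  simp [expectedPayoff, multilinearPayoff]

section PureDeviations

variable [∀ i, DecidableEq (S i)]

/-- What player `i` gains in expectation when she deviates from the profile of weights `x` to the
pure strategy `a`. -/
def deviationGain (G : NormalFormGame ι S) (x : ∀ j, S j → ℝ) (i : ι) (a : S i) : ℝ :=
  G.multilinearPayoff i (Function.update x i (Pi.single a 1)) - G.multilinearPayoff i x

theorem continuous_deviationGain (G : NormalFormGame ι S) (i : ι) (a : S i) :
    Continuous fun x ↦ G.deviationGain x i a :=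
  ((G.multilinearPayoff i).cont.comp (continuous_id.update i continuous_const)).sub
    (G.multilinearPayoff i).cont

theorem sum_mul_deviationGain (G : NormalFormGame ι S) (x : ∀ j, S j → ℝ) (i : ι) {y : S i → ℝ}
    (hy : ∑ a, y a = 1) : ∑ a, y a * G.deviationGain x i a =
      G.multilinearPayoff i (Function.update x i y) - G.multilinearPayoff i x := by
  have hlin : G.multilinearPayoff i (Function.update x i y) =
      ∑ a, y a * G.multilinearPayoff i (Function.update x i (Pi.single a 1)) := by
    have hsingle : ∀ a : S i, (Pi.single a 1 : S i → ℝ) = fun b ↦ if a = b then 1 else 0 :=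
      fun a ↦ funext fun b ↦ by simp only [Pi.single_apply, eq_comm]
    simp only [hsingle]
    exact ((G.multilinearPayoff i).toLinearMap x i).pi_apply_eq_sum_univ y
  simp only [deviationGain, mul_sub, Finset.sum_sub_distrib, ← Finset.sum_mul, hy, one_mul, hlin]

theorem mem_nashEquilibria_iff (G : NormalFormGame ι S) (σ : StrategyProfile ι S) :
    σ ∈ G.nashEquilibria ↔ ∀ i a, G.deviationGain (fun j ↦ σ j) i a ≤ 0 := by
  have hupdate : ∀ i (τ : stdSimplex ℝ (S i)), G.expectedPayoff (Function.update σ i τ) i =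
      G.multilinearPayoff i (Function.update (fun j ↦ σ j) i τ) := fun i τ ↦ by
    rw [expectedPayoff_eq_multilinearPayoff]
    exact congrArg _ (funext (Function.apply_update (fun _ ↦ Subtype.val) σ i τ))
  simp only [nashEquilibria, Set.mem_ofPred_eq, hupdate]
  rw [forall_congr' fun i ↦ forall_congr' fun τ ↦ by rw [expectedPayoff_eq_multilinearPayoff]]
  refine ⟨fun h i a ↦ sub_nonpos.2 (h i ⟨_, single_mem_stdSimplex ℝ a⟩), fun h i τ ↦ ?_⟩
  rw [← sub_nonpos, ← G.sum_mul_deviationGain _ i (stdSimplex.sum_eq_one τ)]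
  exact Finset.sum_nonpos fun a _ ↦ mul_nonpos_of_nonneg_of_nonpos (τ.2.1 a) (h i a)

/-- Nash's map: every player moves weight towards the pure strategies to which she would gain by
deviating, and then renormalizes. -/
noncomputable def nashMap (G : NormalFormGame ι S) (x : ∀ j, S j → ℝ) : ∀ j, S j → ℝ :=
  fun i a ↦ (x i a + (G.deviationGain x i a)⁺) / (1 + ∑ b, (G.deviationGain x i b)⁺)

theorem one_add_sum_posPart_deviationGain_pos (G : NormalFormGame ι S) (x : ∀ j, S j → ℝ)
    (i : ι) : 0 < 1 + ∑ b, (G.deviationGain x i b)⁺ :=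
  add_pos_of_pos_of_nonneg one_pos (Finset.sum_nonneg fun _ _ ↦ posPart_nonneg _)

theorem continuous_nashMap (G : NormalFormGame ι S) : Continuous G.nashMap := by
  have hpos : ∀ i a, Continuous fun x ↦ (G.deviationGain x i a)⁺ := fun i a ↦
    continuous_posPart.comp (G.continuous_deviationGain i a)
  exact continuous_pi fun i ↦ continuous_pi fun a ↦
    .div (.add (by fun_prop) (hpos i a))
      (.add continuous_const (continuous_finsetSum _ fun b _ ↦ hpos i b))
      fun x ↦ (G.one_add_sum_posPart_deviationGain_pos x i).ne'

theorem nashMap_mem_stdSimplex (G : NormalFormGame ι S) {x : ∀ j, S j → ℝ} {i : ι}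
    (hx : x i ∈ stdSimplex ℝ (S i)) : G.nashMap x i ∈ stdSimplex ℝ (S i) := by
  have hpos := G.one_add_sum_posPart_deviationGain_pos x i
  refine ⟨fun a ↦ div_nonneg (add_nonneg (hx.1 a) (posPart_nonneg _)) hpos.le, ?_⟩
  simp only [nashMap]
  rw [← Finset.sum_div, Finset.sum_add_distrib, hx.2, div_self hpos.ne']

theorem deviationGain_nonpos_of_isFixedPt_nashMap (G : NormalFormGame ι S) {x : ∀ j, S j → ℝ}
    (hfix : Function.IsFixedPt G.nashMap x) {i : ι} (hx : ∑ a, x i a = 1) (a : S i) :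
    G.deviationGain x i a ≤ 0 := by
  refine nonpos_of_mul_sum_posPart_eq (x := x i) ?_ (fun b ↦ ?_) a
  · rw [G.sum_mul_deviationGain x i hx, Function.update_eq_self, sub_self]
  · have hb := congrFun (congrFun hfix i) b
    rw [nashMap, div_eq_iff (G.one_add_sum_posPart_deviationGain_pos x i).ne'] at hb
    linarith

end PureDeviations

theorem nashEquilibria_nonempty [∀ i, Nonempty (S i)] (G : NormalFormGame ι S) :
    G.nashEquilibria.Nonempty := by
  classical
  obtain ⟨x, hx, hfix⟩ := exists_isFixedPt_of_isCompact_of_convex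
    (Set.univ_pi_nonempty_iff.2 fun i ↦
      ⟨_, single_mem_stdSimplex ℝ (Classical.arbitrary (S i))⟩)
    (isCompact_univ_pi fun i ↦ isCompact_stdSimplex ℝ (S i))
    (convex_pi fun i _ ↦ convex_stdSimplex ℝ (S i)) G.continuous_nashMap.continuousOn
    fun x hx i hi ↦ G.nashMap_mem_stdSimplex (hx i hi)
  refine ⟨fun i ↦ ⟨x i, hx i (Set.mem_univ i)⟩, (G.mem_nashEquilibria_iff _).2 fun i a ↦ ?_⟩
  exact G.deviationGain_nonpos_of_isFixedPt_nashMap hfix (hx i (Set.mem_univ i)).2 a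

end NormalFormGame

theorem not_adj_of_isMaximalPathFrom {V α : Type*} [Preorder α] {Γ : Digraph V} {f : V → α}
    (hf : ∀ a b, Γ.Adj a b → f b < f a) {r a : V} {p : List V} (hp : Γ.IsMaximalPathFrom r p)
    (hlast : p.getLast? = some a) (b : V) : ¬ Γ.Adj a b := by
  intro hab
  obtain ⟨⟨hhead, hchain, -⟩, hmax⟩ := hp
  have hchain' : (p ++ [b]).IsChain Γ.Adj :=
    hchain.append (.singleton b) (by simpa [hlast] using hab)
  have hdecr : ((p ++ [b]).map f).IsChain (· > ·) := List.isChain_map_of_isChain f hf hchain'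
  have hnodup : (p ++ [b]).Nodup := List.Nodup.of_map f (hdecr.pairwise.imp ne_of_gt)
  have hext : p ++ [b] = p :=
    hmax _ ⟨by rw [List.head?_append, hhead, Option.some_or], hchain', hnodup⟩
      (List.prefix_append p [b])
  exact List.cons_ne_nil b [] (List.append_right_eq_self.1 hext)

theorem characteristicSet_nonempty {ι : Type*} {S : ι → Type*} [∀ i, Fintype (S i)]
    (σ : StrategyProfile ι S) : (characteristicSet σ).Nonempty := by
  have hsupp : ∀ i, ∃ a, 0 < σ i a := fun i ↦ by
    obtain ⟨a, -, ha⟩ := Finset.exists_lt_of_sum_lt (s := Finset.univ) (f := fun _ : S i ↦ (0 : ℝ))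
      (g := σ i) (by simp)
    exact ⟨a, ha⟩
  choose v hv using hsupp
  exact ⟨v, hv⟩

namespace MisinformationGame

section MisinformedPositions

variable {ι : Type*} {S : ι → Type*}

/-- The positions at which the subjective game of some player disagrees with the actual game; their
number measures how far the Adaptation Procedure is from having nothing left to correct. -/
def misinformedPositions (mG : MisinformationGame ι S) : Set (∀ i, S i) :=
  {v | ∃ i, (mG.subjective i).payoff v ≠ mG.actual.payoff v}

variable [Fintype ι] [∀ i, DecidableEq (S i)]

theorem misinformedPositions_updateAt (mG : MisinformationGame ι S) (v : ∀ i, S i) :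
    (mG.updateAt v).misinformedPositions = mG.misinformedPositions \ {v} := by
  ext w
  by_cases hw : w = v <;> simp [misinformedPositions, updateAt, hw]

theorem updateAt_eq_self_iff {mG : MisinformationGame ι S} {v : ∀ i, S i} :
    mG.updateAt v = mG ↔ v ∉ mG.misinformedPositions := by
  refine ⟨fun h hv ↦ ?_, fun hv ↦ ?_⟩
  · rw [← h, misinformedPositions_updateAt] at hv
    exact hv.2 rfl
  · simp only [misinformedPositions, Set.mem_ofPred_eq, not_exists, not_not] at hv
    refine MisinformationGame.ext rfl (funext fun i ↦ NormalFormGame.ext ?_)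
    simp only [updateAt, ← hv i, Function.update_eq_self]

theorem ncard_misinformedPositions_updateAt_lt [∀ i, Finite (S i)] {mG : MisinformationGame ι S}
    {v : ∀ i, S i} (h : mG.updateAt v ≠ mG) :
    (mG.updateAt v).misinformedPositions.ncard < mG.misinformedPositions.ncard := by
  rw [misinformedPositions_updateAt]
  exact Set.ncard_sdiff_singleton_lt_of_mem (not_not.1 (mt updateAt_eq_self_iff.2 h))
    (Set.toFinite _)

end MisinformedPositions

variable {ι : Type*} {S : ι → Type*} [Fintype ι] [DecidableEq ι] [∀ i, Fintype (S i)]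

theorem NME_nonempty [∀ i, Nonempty (S i)] (mG : MisinformationGame ι S) : mG.NME.Nonempty := by
  choose τ hτ using fun i ↦ (mG.subjective i).nashEquilibria_nonempty
  exact ⟨fun i ↦ τ i i, fun i ↦ ⟨τ i, hτ i, rfl⟩⟩

variable [∀ i, DecidableEq (S i)]

/-- A single adaptation step: `adapt M` is the image of `M` under this relation, and the adaptation
graph is its restriction to the games that the procedure produces. -/
def AdaptsTo (mG mG' : MisinformationGame ι S) : Prop :=
  ∃ σ ∈ mG.NME, ∃ v ∈ characteristicSet σ, mG' = mG.updateAt v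

theorem exists_adaptsTo [∀ i, Nonempty (S i)] (mG : MisinformationGame ι S) :
    ∃ mG', mG.AdaptsTo mG' := by
  obtain ⟨σ, hσ⟩ := mG.NME_nonempty
  obtain ⟨v, hv⟩ := characteristicSet_nonempty σ
  exact ⟨_, σ, hσ, v, hv, rfl⟩

theorem adaptsTo_self_of_forall [∀ i, Nonempty (S i)] {mG : MisinformationGame ι S}
    (h : ∀ m, mG.AdaptsTo m → m = mG) : mG.AdaptsTo mG := by
  obtain ⟨m, hm⟩ := mG.exists_adaptsTo
  exact h m hm ▸ hm

theorem AdaptsTo.ncard_misinformedPositions_lt {mG mG' : MisinformationGame ι S}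
    (h : mG.AdaptsTo mG') (hne : mG' ≠ mG) :
    mG'.misinformedPositions.ncard < mG.misinformedPositions.ncard := by
  obtain ⟨σ, -, v, -, rfl⟩ := h
  exact ncard_misinformedPositions_updateAt_lt hne

theorem mem_iterate_adapt_iff {M : Set (MisinformationGame ι S)} {mG' : MisinformationGame ι S}
    {t : ℕ} : mG' ∈ adapt^[t] M ↔ ∃ mG ∈ M, mG' ∈ adapt^[t] {mG} := by
  induction t generalizing mG' with
  | zero => simp
  | succ t ih =>
    simp only [Function.iterate_succ_apply', adapt, Set.mem_ofPred_eq]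
    constructor
    · rintro ⟨m, hm, hstep⟩
      obtain ⟨mG, hmG, hm⟩ := ih.1 hm
      exact ⟨mG, hmG, m, hm, hstep⟩
    · rintro ⟨mG, hmG, m, hm, hstep⟩
      exact ⟨m, ih.2 ⟨mG, hmG, hm⟩, hstep⟩

theorem mem_iterate_succ_adapt_singleton_iff {mG mG' : MisinformationGame ι S} {t : ℕ} :
    mG' ∈ adapt^[t + 1] {mG} ↔ ∃ m, mG.AdaptsTo m ∧ mG' ∈ adapt^[t] {m} := by
  rw [Function.iterate_succ_apply, mem_iterate_adapt_iff]
  simp [adapt, AdaptsTo]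

theorem AdaptsTo.mem_iterate_adapt_singleton {mG : MisinformationGame ι S}
    (h : mG.AdaptsTo mG) (t : ℕ) : mG ∈ adapt^[t] {mG} := by
  induction t with
  | zero => rfl
  | succ t ih => exact mem_iterate_succ_adapt_singleton_iff.2 ⟨mG, h, ih⟩

theorem AdaptsTo.mem_adaptStar {M : Set (MisinformationGame ι S)}
    {mG mG' : MisinformationGame ι S} (h : mG.AdaptsTo mG') (hmG : mG ∈ adaptStar M) :
    mG' ∈ adaptStar M := by
  obtain ⟨t, ht⟩ := Set.mem_iUnion.1 hmG
  refine Set.mem_iUnion.2 ⟨t + 1, ?_⟩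
  rw [Function.iterate_succ_apply']
  exact ⟨mG, ht, h⟩

theorem adapt_singleton_eq_self_of_forall [∀ i, Nonempty (S i)] {mG : MisinformationGame ι S}
    (h : ∀ m, mG.AdaptsTo m → m = mG) : adapt {mG} = {mG} := by
  refine Set.Subset.antisymm ?_ (Set.singleton_subset_iff.2 ⟨mG, rfl, adaptsTo_self_of_forall h⟩)
  rintro m ⟨_, rfl, hm⟩
  exact h m hm

/-- A step other than a loop lowers the bound `t`, and a loop can be traversed once more or once
less. -/
theorem iterate_succ_adapt_singleton_eq [∀ i, Nonempty (S i)] {t : ℕ}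
    {mG : MisinformationGame ι S} (ht : mG.misinformedPositions.ncard ≤ t) :
    adapt^[t + 1] {mG} = adapt^[t] {mG} := by
  induction t generalizing mG with
  | zero =>
    refine adapt_singleton_eq_self_of_forall fun m hm ↦ ?_
    by_contra hne
    exact absurd (hm.ncard_misinformedPositions_lt hne) (by omega)
  | succ t ih =>
    ext mG'
    rw [mem_iterate_succ_adapt_singleton_iff]
    constructor
    · rintro ⟨m, hm, hmG'⟩
      rcases eq_or_ne m mG with rfl | hne
      · exact hmG'
      · rw [ih (by have := hm.ncard_misinformedPositions_lt hne; omega)] at hmG'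
        exact mem_iterate_succ_adapt_singleton_iff.2 ⟨m, hm, hmG'⟩
    · intro hmG'
      obtain ⟨m, hm, hmG''⟩ := mem_iterate_succ_adapt_singleton_iff.1 hmG'
      rcases eq_or_ne m mG with rfl | hne
      · exact ⟨m, hm, hmG'⟩
      · rw [← ih (by have := hm.ncard_misinformedPositions_lt hne; omega)] at hmG''
        exact ⟨m, hm, hmG''⟩

theorem exists_terminatesAt [∀ i, Nonempty (S i)] (M : Set (MisinformationGame ι S)) :
    ∃ t, TerminatesAt M t := by
  let t := Nat.card (∀ i, S i)
  have hsingleton : ∀ mG : MisinformationGame ι S, adapt^[t + 1] {mG} = adapt^[t] {mG} := fun mG ↦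
    iterate_succ_adapt_singleton_eq (Set.ncard_le_card _)
  have hstationary : adapt^[t + 1] M = adapt^[t] M := by
    ext mG'
    rw [mem_iterate_adapt_iff, mem_iterate_adapt_iff (M := M) (t := t)]
    simp only [hsingleton]
  exact ⟨_, Nat.sInf_mem ⟨t, hstationary⟩, fun _ ↦ Nat.sInf_le⟩

theorem AdaptsTo.mem_stableSet [∀ i, Nonempty (S i)] {M : Set (MisinformationGame ι S)}
    {mG : MisinformationGame ι S} (h : mG.AdaptsTo mG) (hmG : mG ∈ adaptStar M) :
    mG ∈ stableSet M := by
  obtain ⟨s, hs⟩ := Set.mem_iUnion.1 hmG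
  obtain ⟨t, ht⟩ := exists_terminatesAt M
  have hfix : adapt (adapt^[t] M) = adapt^[t] M :=
    (Function.iterate_succ_apply' adapt t M).symm.trans ht.1
  refine ⟨t, ht, ?_⟩
  rw [← Function.iterate_fixed hfix s, ← Function.iterate_add_apply, add_comm,
    Function.iterate_add_apply]
  exact mem_iterate_adapt_iff.2 ⟨mG, hs, h.mem_iterate_adapt_singleton t⟩

theorem mem_sinks_iff {mG mG' : MisinformationGame ι S} :
    mG' ∈ mG.sinks ↔ mG' ∈ adaptStar {mG} ∧ ∀ m, mG'.AdaptsTo m → m = mG' := by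
  simp only [sinks, Digraph.outDeg, Set.encard_eq_zero, Set.eq_empty_iff_forall_notMem,
    Set.mem_ofPred_eq]
  constructor
  · rintro ⟨hmem, hsink⟩
    refine ⟨hmem, fun m hm ↦ ?_⟩
    by_contra hne
    exact hsink ⟨m, hm.mem_adaptStar hmem⟩ ⟨hm, fun e ↦ hne (congrArg Subtype.val e).symm⟩
  · rintro ⟨hmem, hsink⟩
    exact ⟨hmem, fun m hm ↦ hm.2 (Subtype.ext (hsink m hm.1).symm)⟩

theorem adaptsTo_self_of_mem_sinks [∀ i, Nonempty (S i)] {mG mG' : MisinformationGame ι S}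
    (h : mG' ∈ mG.sinks) : mG'.AdaptsTo mG' :=
  adaptsTo_self_of_forall (mem_sinks_iff.1 h).2

theorem sinks_subset_terminalSet [∀ i, Nonempty (S i)] (mG : MisinformationGame ι S) :
    mG.sinks ⊆ mG.terminalSet := fun mG' h ↦
  ⟨(mem_sinks_iff.1 h).1, mG', rfl, adaptsTo_self_of_mem_sinks h⟩

theorem NME_subset_SME_of_mem_sinks [∀ i, Nonempty (S i)] {mG mG' : MisinformationGame ι S}
    (h : mG' ∈ mG.sinks) : mG'.NME ⊆ mG.SME := fun σ hσ ↦
  ⟨mG', (adaptsTo_self_of_mem_sinks h).mem_stableSet (mem_sinks_iff.1 h).1, hσ,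
    fun v hv ↦ (mem_sinks_iff.1 h).2 _ ⟨σ, hσ, v, hv, rfl⟩⟩

theorem getLast_mem_sinks {mG : MisinformationGame ι S} {p : List (adaptStar {mG})}
    {r mG' : adaptStar {mG}} (hp : mG.looplessAdaptationGraph.IsMaximalPathFrom r p)
    (hlast : p.getLast? = some mG') : mG'.1 ∈ mG.sinks := by
  have hdecr : ∀ a b, mG.looplessAdaptationGraph.Adj a b →
      b.1.misinformedPositions.ncard < a.1.misinformedPositions.ncard := fun a b h ↦
    AdaptsTo.ncard_misinformedPositions_lt h.1 fun e ↦ h.2 (Subtype.ext e.symm)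
  exact ⟨mG'.2, Set.encard_eq_zero.2 (Set.eq_empty_iff_forall_notMem.2
    (not_adj_of_isMaximalPathFrom hdecr hp hlast))⟩

end MisinformationGame

theorem mainTheorem10 {ι : Type*} {S : ι → Type*} [Fintype ι] [DecidableEq ι]
    [∀ i, Fintype (S i)] [∀ i, DecidableEq (S i)] [∀ i, Nonempty (S i)]
    (mG : MisinformationGame ι S) :
    mG.sinks ⊆ mG.terminalSet ∧
    (∀ mG' ∈ mG.sinks, mG'.NME ⊆ mG.SME) ∧
    (∀ (p : List (MisinformationGame.adaptStar {mG})) (mG' : MisinformationGame.adaptStar {mG}),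
      mG.looplessAdaptationGraph.IsMaximalPathFrom mG.root p → p.getLast? = some mG' →
        mG'.1.NME.Nonempty ∧ mG'.1.NME ⊆ mG.SME) :=
  ⟨mG.sinks_subset_terminalSet,
    fun _ hsink ↦ MisinformationGame.NME_subset_SME_of_mem_sinks hsink,
    fun _ mG' hmax hlast ↦ ⟨mG'.1.NME_nonempty,
      MisinformationGame.NME_subset_SME_of_mem_sinks
        (MisinformationGame.getLast_mem_sinks hmax hlast)⟩⟩
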